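/- **Lemma 4.4.** Let $\Gamma\subseteq\mathbb R^d$ be an open semi-algebraic set (a finite union of sets of the form $\{x : f(x)=0\ \forall f\in F,\ h(x)>0\ \forall h\in H\}$ with $F,H$ collections of real polynomials, $H$ finite), let $\mathbf f:\Gamma\to\mathbb R^k$ be a polynomial map or a rational map defined everywhere on $\Gamma$ (each coordinate is a quotient of two polynomials whose denominator has no zero on $\Gamma$), and let $\Theta_0=\mathbf f(\Gamma)$. Let $\gamma_0\in\Gamma$ and $\theta_0=\mathbf f(\gamma_0)$. If $\theta_0$ is a nonsingular point of $\Theta_0$ and the $k\times d$ Jacobian matrix of $\mathbf f$ at $\gamma_0$ has full rank $\min(k,d)$, then $\theta_0\in\operatorname{int}(\Theta_0)$. Here the Zariski closure $\bar\Theta_0$ is the set of common zeros in $\mathbb R^k$ of all real polynomials vanishing on $\Theta_0$, and $\operatorname{int}(\Theta_0)$ is the union of all subsets of $\Theta_0$ of the form $O\cap\bar\Theta_0$ with $O\subseteq\mathbb R^k$ open. A real algebraic variety $V\subseteq\mathbb R^k$ (the set of common zeros of a collection of real polynomials) is irreducible if it is not the union of two strict subsets that are real algebraic varieties; its irreducible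 components are the maximal irreducible varieties contained in it. For an irreducible variety $V$ whose ideal $\mathcal I(V)$ of polynomials vanishing on $V$ is generated by $g_1,\dots,g_\ell$, a point $\theta\in V$ is singular if the rank of the matrix $(\partial g_i/\partial t_j(\theta))_{i,j}$ is smaller than the maximal rank of $(\partial g_i/\partial t_j(\theta'))_{i,j}$ over $\theta'\in V$ (this does not depend on the generators). A point of a general variety is singular if it is a singular point of one of the irreducible components or lies in two different components. A point of $\Theta_0$ is singular if it is a singular point of $\bar\Theta_0$, and nonsingular otherwise. -/

import Mathlib

noncomputable section

namespace RealAlg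

/-! Points of `ℝⁿ` are functions `Fin n → ℝ`; only the topology of `ℝⁿ`, which does not depend on
the norm, enters below. -/

/-- A basic semi-algebraic set: the common zeros of an arbitrary collection `F` of polynomials at
which, in addition, the finitely many polynomials in `H` are all positive. -/
def IsBasicSemialgebraic {n : ℕ} (S : Set (Fin n → ℝ)) : Prop :=
  ∃ (F : Set (MvPolynomial (Fin n) ℝ)) (H : Finset (MvPolynomial (Fin n) ℝ)),
    S = {x | (∀ f ∈ F, MvPolynomial.eval x f = 0) ∧ ∀ h ∈ H, 0 < MvPolynomial.eval x h}

/-- A semi-algebraic set: a finite union of basic semi-algebraic sets. -/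
def IsSemialgebraic {n : ℕ} (S : Set (Fin n → ℝ)) : Prop :=
  ∃ 𝒮 : Set (Set (Fin n → ℝ)), 𝒮.Finite ∧ (∀ B ∈ 𝒮, IsBasicSemialgebraic B) ∧ S = ⋃₀ 𝒮

/-- A real algebraic variety in `ℝⁿ`: the common zeros of a collection of polynomials. -/
def IsVariety {n : ℕ} (V : Set (Fin n → ℝ)) : Prop :=
  ∃ F : Set (MvPolynomial (Fin n) ℝ), V = {x | ∀ f ∈ F, MvPolynomial.eval x f = 0}

/-- The Zariski closure of `Θ`: the common zeros of the ideal of all polynomials that vanish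
on `Θ`. -/
def zariskiClosure {n : ℕ} (Θ : Set (Fin n → ℝ)) : Set (Fin n → ℝ) :=
  MvPolynomial.zeroLocus ℝ (MvPolynomial.vanishingIdeal ℝ Θ)

/-- The interior of `Θ` relative to its Zariski closure: the union of all subsets of `Θ` that are
the intersection of an open subset of `ℝⁿ` with the Zariski closure of `Θ`. -/
def relInterior {n : ℕ} (Θ : Set (Fin n → ℝ)) : Set (Fin n → ℝ) :=
  ⋃₀ {U | U ⊆ Θ ∧ ∃ O : Set (Fin n → ℝ), IsOpen O ∧ U = O ∩ zariskiClosure Θ}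

/-- A variety is irreducible if it is not the union of two strict subsets that are varieties. -/
def IsIrreducibleVariety {n : ℕ} (V : Set (Fin n → ℝ)) : Prop :=
  IsVariety V ∧ ¬ ∃ A B : Set (Fin n → ℝ),
    IsVariety A ∧ IsVariety B ∧ A ⊂ V ∧ B ⊂ V ∧ V = A ∪ B

/-- The irreducible components of `V`: the maximal irreducible varieties contained in `V`. -/
def IsComponent {n : ℕ} (V C : Set (Fin n → ℝ)) : Prop :=
  Maximal (fun W => IsIrreducibleVariety W ∧ W ⊆ V) C

/-- The Jacobian matrix `∂gᵢ/∂tⱼ (θ)` of a finite family of polynomials. -/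
def polyJacobian {n l : ℕ} (g : Fin l → MvPolynomial (Fin n) ℝ) (θ : Fin n → ℝ) :
    Matrix (Fin l) (Fin n) ℝ :=
  Matrix.of fun i j => MvPolynomial.eval θ (MvPolynomial.pderiv j (g i))

/-- `θ` is a singular point of the irreducible variety `V`: for a finite generating family `g` of
the vanishing ideal of `V`, the rank of the Jacobian matrix of `g` at `θ` is smaller than the
maximum of its ranks at the points of `V`, that is, smaller than the rank at some point of `V`.
Ranks at points of `V` do not depend on the choice of `g`, and some `g` exists by Hilbert's basis
theorem. -/
def IsSingularOfIrreducible {n : ℕ} (V : Set (Fin n → ℝ)) (θ : Fin n → ℝ) : Prop :=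
  θ ∈ V ∧ ∃ (l : ℕ) (g : Fin l → MvPolynomial (Fin n) ℝ),
    Ideal.span (Set.range g) = MvPolynomial.vanishingIdeal ℝ V ∧
    ∃ θ' ∈ V, (polyJacobian g θ).rank < (polyJacobian g θ').rank

/-- `θ` is a singular point of the variety `V`: it is a singular point of an irreducible component
or it lies on two different irreducible components. (If `V` is irreducible, then `V` is its only
component and this is `IsSingularOfIrreducible V θ`.) -/
def IsSingularOfVariety {n : ℕ} (V : Set (Fin n → ℝ)) (θ : Fin n → ℝ) : Prop :=
  (∃ C, IsComponent V C ∧ IsSingularOfIrreducible C θ) ∨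
    ∃ C C', IsComponent V C ∧ IsComponent V C' ∧ C ≠ C' ∧ θ ∈ C ∩ C'

/-- `θ` is a singular point of the set `Θ`: it belongs to `Θ` and is a singular point of the
Zariski closure of `Θ`. -/
def IsSingularPoint {n : ℕ} (Θ : Set (Fin n → ℝ)) (θ : Fin n → ℝ) : Prop :=
  θ ∈ Θ ∧ IsSingularOfVariety (zariskiClosure Θ) θ

/-- On `Γ`, the map `f` is a rational map defined everywhere: its coordinates are quotients of
polynomials whose denominators have no zero on `Γ`. Polynomial maps are the case `q = 1`. Nothing
is said about `f` outside `Γ`. -/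
def IsRationalMapOn {d k : ℕ} (f : (Fin d → ℝ) → (Fin k → ℝ)) (Γ : Set (Fin d → ℝ)) : Prop :=
  ∃ p q : Fin k → MvPolynomial (Fin d) ℝ, ∀ γ ∈ Γ, ∀ i,
    MvPolynomial.eval γ (q i) ≠ 0 ∧
    f γ i = MvPolynomial.eval γ (p i) / MvPolynomial.eval γ (q i)

/-- The `k × d` Jacobian matrix of the map `f` at `γ`. -/
def jacobian {d k : ℕ} (f : (Fin d → ℝ) → (Fin k → ℝ)) (γ : Fin d → ℝ) :
    Matrix (Fin k) (Fin d) ℝ :=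
  LinearMap.toMatrix' (fderiv ℝ f γ : (Fin d → ℝ) →ₗ[ℝ] (Fin k → ℝ))

end RealAlg

end

section

open Filter Topology MvPolynomial

/-! ### Algebraic independence and the Jacobian criterion. -/

namespace MvPolynomial

/-! If `k ≤ d`, then `f` is a submersion at `γ₀`, so its image is a neighbourhood of `θ₀`. If `d <
k`, then `f` is an immersion into the Zariski closure `V`, and the point is that `V` is no larger
than the image near `θ₀`. The vanishing ideal of the image is the kernel of a map to the field of
rational functions in `d` variables. Hence it is prime, `V` is irreducible, and at most `d`
coordinates are independent on `V`. By the Jacobian criterion some tangent space of `V` has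
dimension at most `d` (`exists_finrank_ker_polyJacobian_le`), and nonsingularity carries this bound
to `θ₀`. The tangent space at `θ₀` contains the `d`-dimensional range of the derivative of `f`, so
the two agree, and the inverse function theorem shows that `f` fills `V` near `θ₀`
(`eventually_mem_image_of_ker_le_range`). -/

theorem vars_pderiv_subset {R σ : Type*} [CommSemiring R] (p : MvPolynomial σ R) (j : σ) :
    (pderiv j p).vars ⊆ p.vars := by
  intro i hi
  obtain ⟨m, hm, him⟩ := (mem_vars_iff_mem_support i).1 hi
  refine (mem_vars_iff_mem_support i).2 ⟨m + Finsupp.single j 1, ?_, ?_⟩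
  · rw [mem_support_iff, coeff_pderiv] at hm
    exact mem_support_iff.2 (left_ne_zero_of_mul hm)
  · simp only [Finsupp.mem_support_iff, Finsupp.add_apply] at him ⊢
    omega

theorem totalDegree_pderiv_lt {R σ : Type*} [CommSemiring R] {p : MvPolynomial σ R} {j : σ}
    (h : pderiv j p ≠ 0) : (pderiv j p).totalDegree < p.totalDegree := by
  obtain ⟨m, hm, hd⟩ := Finset.exists_mem_eq_sup _ (support_nonempty.2 h)
    (fun m : σ →₀ ℕ => m.sum fun _ e => e)
  have hm' : m + Finsupp.single j 1 ∈ p.support := by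
    rw [mem_support_iff, coeff_pderiv] at hm
    exact mem_support_iff.2 (left_ne_zero_of_mul hm)
  have h1 := le_totalDegree hm'
  rw [Finsupp.sum_add_index' (fun _ => rfl) (fun _ _ _ => rfl),
    Finsupp.sum_single_index rfl] at h1
  rw [totalDegree, hd]
  omega

theorem notMem_vars_of_pderiv_eq_zero {R σ : Type*} [CommSemiring R] [NoZeroDivisors R]
    [CharZero R] {p : MvPolynomial σ R} {j : σ} (h : pderiv j p = 0) : j ∉ p.vars := by
  intro hj
  obtain ⟨m, hm, hjm⟩ := (mem_vars_iff_mem_support j).1 hj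
  have hle : Finsupp.single j 1 ≤ m := by
    rw [Finsupp.single_le_iff]
    exact Nat.one_le_iff_ne_zero.2 (Finsupp.mem_support_iff.1 hjm)
  have h1 := coeff_pderiv p (m - Finsupp.single j 1) (i := j)
  rw [h, coeff_zero, tsub_add_cancel_of_le hle] at h1
  rcases mul_eq_zero.1 h1.symm with h2 | h2
  · exact mem_support_iff.1 hm h2
  · exact Nat.cast_add_one_ne_zero _ h2

/-- Jacobian criterion in characteristic zero, for a prime ideal presented as a kernel: outside a
set of algebraically independent coordinates, each coordinate `j` satisfies a relation that
involves no further coordinate and whose derivative in the direction `j` does not vanish. -/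
theorem exists_algebraicIndependent_pderiv_ne_zero {F A σ : Type*} [Field F] [CharZero F]
    [Finite σ] [CommRing A] [Nontrivial A] [Algebra F A] (φ : MvPolynomial σ F →ₐ[F] A) :
    ∃ S : Set σ, AlgebraicIndependent F (fun i : S => φ (X i)) ∧
      ∀ j ∉ S, ∃ G : MvPolynomial σ F, φ G = 0 ∧ (G.vars : Set σ) ⊆ insert j S ∧
        φ (pderiv j G) ≠ 0 := by
  let Indep : Set σ → Prop := fun S =>
    ∀ G : MvPolynomial σ F, (G.vars : Set σ) ⊆ S → φ G = 0 → G = 0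
  have h0 : Indep ∅ := by
    intro G hG h
    have hG' : G ∈ supported F (∅ : Set σ) := mem_supported.2 hG
    rw [supported_empty] at hG'
    obtain ⟨c, rfl⟩ := Algebra.mem_bot.1 hG'
    rw [AlgHom.commutes] at h
    rw [(map_eq_zero_iff _ (algebraMap F A).injective).1 h, map_zero]
  obtain ⟨S, hS⟩ := Set.Finite.exists_maximal (Set.toFinite {S | Indep S}) ⟨∅, h0⟩
  have hS' : ∀ G : MvPolynomial σ F, (G.vars : Set σ) ⊆ S → φ G = 0 → G = 0 := hS.prop
  refine ⟨S, ?_, fun j hj => ?_⟩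
  · rw [AlgebraicIndependent, injective_iff_map_eq_zero]
    intro q hq
    have hc : φ.comp (rename (Subtype.val : S → σ)) = aeval (fun i : S => φ (X i)) :=
      algHom_ext fun i => by
        rw [AlgHom.comp_apply, rename_X, aeval_X]
    have h1 : φ (rename (Subtype.val : S → σ) q) = 0 := (DFunLike.congr_fun hc q).trans hq
    have h2 := hS' (rename (Subtype.val : S → σ) q) (by
      rw [← mem_supported, supported_eq_range_rename]
      exact (rename (Subtype.val : S → σ)).mem_range_self q) h1
    exact rename_injective _ Subtype.val_injective (by rw [h2, map_zero])
  -- Otherwise differentiating in direction `j` turns each relation over `insert j S` into one of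
  -- smaller degree, which is zero by induction. In characteristic zero `j` then does not occur, so
  -- the relation lives over `S` and is trivial, against maximality of `S`.
  · by_contra! hcon
    have hIns : Indep (insert j S) := by
      intro G
      induction hn : G.totalDegree using Nat.strong_induction_on generalizing G with
      | _ n ih =>
        intro hG hφ
        have hd := hcon G hφ hG
        have hz : pderiv j G = 0 := by
          by_contra hne
          exact hne (ih _ (hn ▸ totalDegree_pderiv_lt hne) _ rfl
            ((Finset.coe_subset.2 (vars_pderiv_subset G j)).trans hG) hd)
        refine hS' G (fun i hi => ?_) hφ
        rcases hG hi with rfl | h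
        · exact absurd hi (notMem_vars_of_pderiv_eq_zero hz)
        · exact h
    exact hj (hS.le_of_ge hIns (Set.subset_insert j S) (Set.mem_insert j S))

theorem trdeg_fractionRing (F σ : Type) [Field F] :
    Algebra.trdeg F (FractionRing (MvPolynomial σ F)) = Cardinal.mk σ := by
  have : Algebra.IsAlgebraic (MvPolynomial σ F) (FractionRing (MvPolynomial σ F)) :=
    IsLocalization.isAlgebraic _ (nonZeroDivisors (MvPolynomial σ F))
  rw [← trdeg_add_eq F (MvPolynomial σ F) (A := FractionRing (MvPolynomial σ F)),
    trdeg_of_isDomain, trdeg_eq_zero, add_zero, Cardinal.lift_id]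

theorem eq_zero_of_eval_eq_zero_on_open {n : ℕ} {U : Set (Fin n → ℝ)} (hU : IsOpen U)
    (hne : U.Nonempty) {p : MvPolynomial (Fin n) ℝ} (h : ∀ x ∈ U, eval x p = 0) : p = 0 := by
  obtain ⟨a, ha⟩ := hne
  obtain ⟨ε, hε, hb⟩ := Metric.isOpen_iff.1 hU a ha
  refine funext_set (fun i => Metric.ball (a i) ε) (fun i => ?_) fun x hx => ?_
  · rw [Real.ball_eq_Ioo]
    exact Set.Ioo_infinite (by linarith)
  · rw [map_zero]
    refine h x (hb ?_)
    rwa [ball_pi _ hε]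

end MvPolynomial

/-- A rational map defined everywhere on a nonempty open set is the same as a homomorphism to the
field of rational functions: polynomial relations can be read off on either side. -/
theorem RealAlg.IsRationalMapOn.exists_algHom {d k : ℕ} {f : (Fin d → ℝ) → (Fin k → ℝ)}
    {Γ : Set (Fin d → ℝ)} (hf : RealAlg.IsRationalMapOn f Γ) (hΓ : IsOpen Γ) (hne : Γ.Nonempty) :
    ∃ φ : MvPolynomial (Fin k) ℝ →ₐ[ℝ] FractionRing (MvPolynomial (Fin d) ℝ),
      RingHom.ker φ = vanishingIdeal ℝ (f '' Γ) := by
  obtain ⟨p, q, hpq⟩ := hf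
  let K := FractionRing (MvPolynomial (Fin d) ℝ)
  let ι : MvPolynomial (Fin d) ℝ →+* K := algebraMap _ _
  have hι : Function.Injective ι := IsFractionRing.injective _ _
  obtain ⟨a, ha⟩ := hne
  have hnz : ∀ s : MvPolynomial (Fin d) ℝ, (∀ γ ∈ Γ, eval γ s ≠ 0) → ι s ≠ 0 := by
    intro s hs h
    rw [(map_eq_zero_iff ι hι).1 h] at hs
    exact hs a ha (map_zero _)
  let φ : MvPolynomial (Fin k) ℝ →ₐ[ℝ] K := aeval fun i => ι (p i) / ι (q i)
  -- One fraction `n / s`, with `s` nowhere zero on `Γ`, represents both `φ G` and the function `G ∘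
  -- f` on `Γ`.
  have key : ∀ G : MvPolynomial (Fin k) ℝ, ∃ n s : MvPolynomial (Fin d) ℝ,
      φ G * ι s = ι n ∧ ∀ γ ∈ Γ, eval γ s ≠ 0 ∧ eval (f γ) G * eval γ s = eval γ n := by
    intro G
    induction G using MvPolynomial.induction_on with
    | C c =>
      refine ⟨C c, 1, ?_, fun γ _ => by simp⟩
      rw [map_one, mul_one]
      exact (AlgHom.commutes φ c).trans
        (IsScalarTower.algebraMap_apply ℝ (MvPolynomial (Fin d) ℝ) K c)
    | add G G' h h' =>
      obtain ⟨n, s, h1, h2⟩ := h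
      obtain ⟨n', s', h1', h2'⟩ := h'
      refine ⟨n * s' + n' * s, s * s', ?_, fun γ hγ => ⟨?_, ?_⟩⟩
      · simp only [map_add, map_mul, ← h1, ← h1']
        ring
      · rw [map_mul]
        exact mul_ne_zero (h2 γ hγ).1 (h2' γ hγ).1
      · simp only [map_add, map_mul, ← (h2 γ hγ).2, ← (h2' γ hγ).2]
        ring
    | mul_X G i h =>
      obtain ⟨n, s, h1, h2⟩ := h
      have hq : ι (q i) ≠ 0 := hnz _ fun γ hγ => (hpq γ hγ i).1
      refine ⟨n * p i, s * q i, ?_, fun γ hγ => ⟨?_, ?_⟩⟩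
      · have hX : φ (X i) * ι (q i) = ι (p i) := by
          simp only [φ, aeval_X]
          exact div_mul_cancel₀ _ hq
        simp only [map_mul, ← h1, ← hX]
        ring
      · rw [map_mul]
        exact mul_ne_zero (h2 γ hγ).1 (hpq γ hγ i).1
      · have hX : f γ i * eval γ (q i) = eval γ (p i) := by
          rw [(hpq γ hγ i).2, div_mul_cancel₀ _ (hpq γ hγ i).1]
        simp only [map_mul, eval_X, ← (h2 γ hγ).2, ← hX]
        ring
  refine ⟨φ, ?_⟩
  ext G
  obtain ⟨n, s, h1, h2⟩ := key G
  rw [RingHom.mem_ker, mem_vanishingIdeal_iff, Set.forall_mem_image]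
  constructor
  · intro h γ hγ
    change eval (f γ) G = 0
    rw [h, zero_mul] at h1
    have h3 := (h2 γ hγ).2
    rw [(map_eq_zero_iff ι hι).1 h1.symm, map_zero] at h3
    exact (mul_eq_zero.1 h3).resolve_right (h2 γ hγ).1
  · intro h
    have hn : n = 0 := eq_zero_of_eval_eq_zero_on_open hΓ ⟨a, ha⟩ fun γ hγ => by
      rw [← (h2 γ hγ).2, show eval (f γ) G = 0 from h hγ, zero_mul]
    rw [hn, map_zero] at h1
    exact (mul_eq_zero.1 h1).resolve_right (hnz s fun γ hγ => (h2 γ hγ).1)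

/-! ### Consequences of the inverse function theorem. -/

/-- A map whose strict derivative is injective is locally injective. -/
theorem HasStrictFDerivAt.exists_injOn_of_injective {E F : Type*} [NormedAddCommGroup E]
    [NormedSpace ℝ E] [FiniteDimensional ℝ E] [NormedAddCommGroup F] [NormedSpace ℝ F]
    [FiniteDimensional ℝ F] {f : E → F} {f' : E →L[ℝ] F} {a : E} (hf : HasStrictFDerivAt f f' a)
    (hinj : Function.Injective f') : ∃ U ∈ 𝓝 a, Set.InjOn f U := by
  obtain ⟨g, hg⟩ := LinearMap.exists_leftInverse_of_injective (f' : E →ₗ[ℝ] F)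
    (LinearMap.ker_eq_bot.2 hinj)
  have : CompleteSpace E := FiniteDimensional.complete ℝ E
  have h1 : HasStrictFDerivAt (fun x => LinearMap.toContinuousLinearMap g (f x))
      ((ContinuousLinearEquiv.refl ℝ E : E ≃L[ℝ] E) : E →L[ℝ] E) a := by
    convert! (LinearMap.toContinuousLinearMap g).hasStrictFDerivAt.comp a hf using 1
    ext x
    exact (LinearMap.congr_fun hg x).symm
  refine ⟨_, (h1.toOpenPartialHomeomorph _).open_source.mem_nhds
    h1.mem_toOpenPartialHomeomorph_source, fun x hx y hy hxy => ?_⟩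
  exact (h1.toOpenPartialHomeomorph _).injOn hx hy
    (congrArg (LinearMap.toContinuousLinearMap g) hxy)

/-- If `f` is an immersion at `a` into the zero set of `g`, and the derivative of `g` at `f a`
vanishes only on the image of that of `f`, then near `f a` the image of `f` fills the zero set. -/
theorem HasStrictFDerivAt.eventually_mem_image_of_ker_le_range {E F G : Type*}
    [NormedAddCommGroup E] [NormedSpace ℝ E] [FiniteDimensional ℝ E]
    [NormedAddCommGroup F] [NormedSpace ℝ F] [FiniteDimensional ℝ F]
    [NormedAddCommGroup G] [NormedSpace ℝ G] [FiniteDimensional ℝ G]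
    {f : E → F} {f' : E →L[ℝ] F} {g : F → G} {g' : F →L[ℝ] G} {a : E} {U : Set E}
    (hf : HasStrictFDerivAt f f' a) (hg : HasStrictFDerivAt g g' (f a))
    (hinj : Function.Injective f') (hker : ∀ y, g' y = 0 → ∃ x, f' x = y)
    (hU : U ∈ 𝓝 a) (hfg : ∀ x ∈ U, g (f x) = 0) :
    ∀ᶠ y in 𝓝 (f a), g y = 0 → y ∈ f '' U := by
  have : CompleteSpace E := FiniteDimensional.complete ℝ E
  obtain ⟨r, hr⟩ := LinearMap.exists_leftInverse_of_injective (f' : E →ₗ[ℝ] F)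
    (LinearMap.ker_eq_bot.2 hinj)
  let π : F →L[ℝ] E := LinearMap.toContinuousLinearMap r
  have hπ : ∀ x, π (f' x) = x := fun x => LinearMap.congr_fun hr x
  have h1 : HasStrictFDerivAt (fun x => π (f x)) (π.comp f') a :=
    π.hasStrictFDerivAt.comp a hf
  have h2 : HasStrictFDerivAt (fun y => (π y, g y)) (π.prod g') (f a) :=
    π.hasStrictFDerivAt.prodMk hg
  -- A vector killed by `g'` is tangent to the image of `f`, where the left inverse `π` detects it.
  obtain ⟨W, hW, hWinj⟩ := h2.exists_injOn_of_injective (by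
    rw [injective_iff_map_eq_zero]
    intro y hy
    obtain ⟨hy1, hy2⟩ := Prod.mk.inj hy
    obtain ⟨x, rfl⟩ := hker y hy2
    have : x = 0 := (hπ x).symm.trans hy1
    rw [this, map_zero])
  have hN : U ∩ f ⁻¹' W ∈ 𝓝 a := inter_mem hU (hf.continuousAt.preimage_mem_nhds hW)
  -- `π ∘ f` has identity derivative, so it attains every value near `π (f a)`, and does so at
  -- points that `f` sends into `W`.
  have hI : (fun x => π (f x)) '' (U ∩ f ⁻¹' W) ∈ 𝓝 (π (f a)) := by
    rw [← h1.map_nhds_eq_of_surj (LinearMap.range_eq_top.2 fun x => ⟨x, hπ x⟩)]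
    exact image_mem_map hN
  filter_upwards [hW, π.continuous.continuousAt.preimage_mem_nhds hI] with y hyW hyI hy
  obtain ⟨x, ⟨hxU, hxW⟩, hxy⟩ := hyI
  refine ⟨x, hxU, hWinj hxW hyW (Prod.ext hxy ?_)⟩
  exact (hfg x hxU).trans hy.symm

/-! ### Derivatives of polynomial and rational maps. -/

namespace MvPolynomial

theorem hasStrictFDerivAt_eval {n : ℕ} (p : MvPolynomial (Fin n) ℝ) (a : Fin n → ℝ) :
    HasStrictFDerivAt (fun x => eval x p)
      (∑ j, eval a (pderiv j p) • (ContinuousLinearMap.proj j : (Fin n → ℝ) →L[ℝ] ℝ)) a := by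
  induction p using MvPolynomial.induction_on with
  | C c => simpa using hasStrictFDerivAt_const c a
  | add p q hp hq =>
    simp only [map_add, add_smul, Finset.sum_add_distrib]
    exact hp.add hq
  | mul_X p i hp =>
    simp only [map_mul, eval_X]
    convert! hp.mul (ContinuousLinearMap.proj i : (Fin n → ℝ) →L[ℝ] ℝ).hasStrictFDerivAt using 1
    ext v
    have h : ∀ j, eval a (pderiv j (p * X i)) * v j =
        a i * (eval a (pderiv j p) * v j) + if i = j then eval a p * v j else 0 := fun j => by
      rw [pderiv_mul, pderiv_X, Pi.single_apply]
      split_ifs <;> simp <;> ring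
    simp [-Derivation.leibniz, h, Finset.sum_add_distrib, Finset.mul_sum, add_comm]

end MvPolynomial

namespace RealAlg

theorem hasStrictFDerivAt_polyJacobian {n l : ℕ} (g : Fin l → MvPolynomial (Fin n) ℝ)
    (a : Fin n → ℝ) :
    HasStrictFDerivAt (fun x i => MvPolynomial.eval x (g i))
      (LinearMap.toContinuousLinearMap (polyJacobian g a).mulVecLin) a := by
  refine hasStrictFDerivAt_pi'.2 fun i => ?_
  convert! (g i).hasStrictFDerivAt_eval a using 1
  ext v
  simp [polyJacobian, Matrix.mulVec, dotProduct]

theorem IsRationalMapOn.hasStrictFDerivAt {d k : ℕ} {f : (Fin d → ℝ) → (Fin k → ℝ)}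
    {Γ : Set (Fin d → ℝ)} (hf : IsRationalMapOn f Γ) {a : Fin d → ℝ} (ha : Γ ∈ 𝓝 a) :
    HasStrictFDerivAt f (fderiv ℝ f a) a := by
  obtain ⟨p, q, hpq⟩ := hf
  have h : ∀ i, ∃ f' : (Fin d → ℝ) →L[ℝ] ℝ, HasStrictFDerivAt (fun x => f x i) f' a := by
    refine fun i => ⟨_, (((p i).hasStrictFDerivAt_eval a).mul
      ((hasStrictDerivAt_inv (hpq a (mem_of_mem_nhds ha) i).1).comp_hasStrictFDerivAt a
        ((q i).hasStrictFDerivAt_eval a))).congr_of_eventuallyEq ?_⟩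
    filter_upwards [ha] with x hx
    rw [(hpq x hx i).2, div_eq_mul_inv]
    rfl
  choose f' hf' using h
  have h := hasStrictFDerivAt_pi.2 hf'
  rwa [← h.hasFDerivAt.fderiv] at h

end RealAlg

/-! ### Irreducibility and tangent spaces of the Zariski closure. -/

namespace RealAlg

theorem isVariety_zariskiClosure {n : ℕ} (Θ : Set (Fin n → ℝ)) : IsVariety (zariskiClosure Θ) :=
  ⟨vanishingIdeal ℝ Θ, rfl⟩

theorem subset_zariskiClosure {n : ℕ} (Θ : Set (Fin n → ℝ)) : Θ ⊆ zariskiClosure Θ :=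
  zeroLocus_vanishingIdeal_le Θ

theorem vanishingIdeal_zariskiClosure {n : ℕ} (Θ : Set (Fin n → ℝ)) :
    vanishingIdeal ℝ (zariskiClosure Θ) = vanishingIdeal ℝ Θ :=
  le_antisymm (vanishingIdeal_anti_mono (subset_zariskiClosure Θ))
    (le_vanishingIdeal_zeroLocus _)

theorem exists_eval_ne_zero_of_isVariety_ssubset {n : ℕ} {A V : Set (Fin n → ℝ)}
    (hA : IsVariety A) (h : A ⊂ V) : ∃ p ∉ vanishingIdeal ℝ V, ∀ x ∈ A, eval x p = 0 := by
  obtain ⟨F, rfl⟩ := hA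
  obtain ⟨x, hxV, hx⟩ := Set.exists_of_ssubset h
  simp only [Set.mem_ofPred_eq, not_forall] at hx
  obtain ⟨p, hp, hpx⟩ := hx
  exact ⟨p, fun hI => hpx (hI x hxV), fun y hy => hy p hp⟩

theorem isIrreducibleVariety_zariskiClosure {n : ℕ} {Θ : Set (Fin n → ℝ)}
    (h : (vanishingIdeal ℝ Θ).IsPrime) : IsIrreducibleVariety (zariskiClosure Θ) := by
  refine ⟨isVariety_zariskiClosure Θ, ?_⟩
  rintro ⟨A, B, hA, hB, hAV, hBV, hV⟩
  obtain ⟨p, hp, hpA⟩ := exists_eval_ne_zero_of_isVariety_ssubset hA hAV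
  obtain ⟨q, hq, hqB⟩ := exists_eval_ne_zero_of_isVariety_ssubset hB hBV
  rw [← vanishingIdeal_zariskiClosure] at h
  refine (h.mem_or_mem (x := p) (y := q) fun x hx => ?_).elim hp hq
  change eval x (p * q) = 0
  rw [map_mul]
  rcases hV.subset hx with hx | hx
  · rw [hpA x hx, zero_mul]
  · rw [hqB x hx, mul_zero]

theorem isComponent_self {n : ℕ} {V : Set (Fin n → ℝ)} (h : IsIrreducibleVariety V) :
    IsComponent V V :=
  ⟨⟨h, subset_rfl⟩, fun _ hW _ => hW.2⟩

theorem finrank_ker_polyJacobian {n l : ℕ} (g : Fin l → MvPolynomial (Fin n) ℝ)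
    (a : Fin n → ℝ) : (polyJacobian g a).rank +
      Module.finrank ℝ (LinearMap.ker (polyJacobian g a).mulVecLin) = n := by
  simpa [Matrix.rank] using (polyJacobian g a).mulVecLin.finrank_range_add_finrank_ker

/-- The kernel of the Jacobian matrix of generators of an ideal is the tangent space: it is
annihilated by the gradients of all polynomials in the ideal. -/
theorem sum_pderiv_mul_eq_zero_of_mem_span {n l : ℕ} {g : Fin l → MvPolynomial (Fin n) ℝ}
    {a v : Fin n → ℝ} (ha : ∀ i, eval a (g i) = 0) (hv : (polyJacobian g a).mulVec v = 0)
    {G : MvPolynomial (Fin n) ℝ} (hG : G ∈ Ideal.span (Set.range g)) :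
    ∑ j, eval a (pderiv j G) * v j = 0 := by
  -- Vanishing at `a` is carried along because it kills one of the two Leibniz terms for a multiple
  -- `c • p`.
  suffices h : eval a G = 0 ∧ ∑ j, eval a (pderiv j G) * v j = 0 from h.2
  induction hG using Submodule.span_induction with
  | mem G h =>
    obtain ⟨i, rfl⟩ := h
    exact ⟨ha i, congrFun hv i⟩
  | zero => simp
  | add p q _ _ hp hq =>
    simp only [map_add, add_mul, Finset.sum_add_distrib, hp.1, hp.2, hq.1, hq.2, add_zero,
      and_self]
  | smul c p _ hp =>
    refine ⟨by rw [smul_eq_mul, map_mul, hp.1, mul_zero], ?_⟩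
    have h : ∀ j, eval a (pderiv j (c • p)) * v j = eval a c * (eval a (pderiv j p) * v j) :=
      fun j => by
        rw [smul_eq_mul, pderiv_mul, map_add, map_mul, map_mul, hp.1]
        ring
    simp only [h, ← Finset.mul_sum, hp.2, mul_zero]

/-- If the polynomials `G j`, `j ∉ S`, form a triangular system with nonzero diagonal at `a`, then
the tangent space at `a` has dimension at most `#S`. -/
theorem finrank_ker_polyJacobian_le {n l : ℕ} {g : Fin l → MvPolynomial (Fin n) ℝ}
    {a : Fin n → ℝ} (ha : ∀ i, eval a (g i) = 0) (S : Set (Fin n))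
    (G : Fin n → MvPolynomial (Fin n) ℝ) (hG : ∀ j ∉ S, G j ∈ Ideal.span (Set.range g))
    (hvars : ∀ j ∉ S, ((G j).vars : Set (Fin n)) ⊆ insert j S)
    (hne : ∀ j ∉ S, eval a (pderiv j (G j)) ≠ 0) :
    Module.finrank ℝ (LinearMap.ker (polyJacobian g a).mulVecLin) ≤ Nat.card S := by
  classical
  -- A tangent vector is determined by its `S`-coordinates: if they vanish, the relation `G j`
  -- forces the `j`-th one to vanish.
  let r : LinearMap.ker (polyJacobian g a).mulVecLin →ₗ[ℝ] (S → ℝ) :=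
    (LinearMap.funLeft ℝ ℝ ((↑) : S → Fin n)).comp (Submodule.subtype _)
  have hr : Function.Injective r := by
    rw [injective_iff_map_eq_zero]
    rintro ⟨v, hv⟩ h
    have hS : ∀ i ∈ S, v i = 0 := fun i hi => congrFun h ⟨i, hi⟩
    ext j
    by_cases hj : j ∈ S
    · exact hS j hj
    have h1 := sum_pderiv_mul_eq_zero_of_mem_span ha hv (hG j hj)
    rw [Finset.sum_eq_single j (fun i _ hij => ?_) (by simp)] at h1
    · exact (mul_eq_zero.1 h1).resolve_left (hne j hj)
    · by_cases hi : i ∈ S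
      · rw [hS i hi, mul_zero]
      · rw [pderiv_eq_zero_of_notMem_vars fun hm => (hvars j hj hm).elim hij hi, map_zero,
          zero_mul]
  have := LinearMap.finrank_le_finrank_of_injective hr
  rwa [Module.finrank_pi, ← Nat.card_eq_fintype_card] at this

/-- The Zariski closure of the image of a rational map in `d` variables has dimension at most `d`:
somewhere, the tangent space has dimension at most `d`. -/
theorem exists_finrank_ker_polyJacobian_le {d k l : ℕ} {Θ : Set (Fin k → ℝ)}
    (φ : MvPolynomial (Fin k) ℝ →ₐ[ℝ] FractionRing (MvPolynomial (Fin d) ℝ))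
    (hφ : RingHom.ker φ = vanishingIdeal ℝ Θ) {g : Fin l → MvPolynomial (Fin k) ℝ}
    (hg : Ideal.span (Set.range g) = vanishingIdeal ℝ Θ) :
    ∃ θ ∈ Θ, Module.finrank ℝ (LinearMap.ker (polyJacobian g θ).mulVecLin) ≤ d := by
  classical
  obtain ⟨S, hS, hG⟩ := exists_algebraicIndependent_pderiv_ne_zero φ
  have hcard : Nat.card S ≤ d := by
    have := hS.cardinalMk_le_trdeg
    rw [trdeg_fractionRing, Cardinal.mk_fin] at this
    rwa [← Nat.cast_card, Nat.cast_le] at this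
  choose! G hG0 hGv hGd using hG
  -- The target of `φ` is a field, so the product of the diagonal derivatives survives; hence all of
  -- them are nonzero at a common point of `Θ`.
  have hprod : ∏ j ∈ (Finset.univ.filter (· ∉ S)), pderiv j (G j) ∉ vanishingIdeal ℝ Θ := by
    rw [← hφ, RingHom.mem_ker, map_prod, ← ne_eq, Finset.prod_ne_zero_iff]
    exact fun j hj => hGd j (Finset.mem_filter.1 hj).2
  rw [mem_vanishingIdeal_iff] at hprod
  push Not at hprod
  obtain ⟨θ, hθ, hne⟩ := hprod
  change eval θ _ ≠ 0 at hne
  rw [map_prod, Finset.prod_ne_zero_iff] at hne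
  have hgθ : ∀ i, eval θ (g i) = 0 := fun i =>
    (hg ▸ Ideal.subset_span (Set.mem_range_self i) : g i ∈ vanishingIdeal ℝ Θ) θ hθ
  refine ⟨θ, hθ, (finrank_ker_polyJacobian_le hgθ S G (fun j hj => ?_) hGv
    fun j hj => hne j (by simpa using hj)).trans hcard⟩
  rw [hg, ← hφ]
  exact hG0 j hj

end RealAlg

end

/-! ### The submersion and immersion cases. -/

open Filter Topology MvPolynomial in
theorem lemma4p4 {d k : ℕ} (Γ : Set (Fin d → ℝ)) (hΓ_open : IsOpen Γ)
    (hΓ : RealAlg.IsSemialgebraic Γ)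
    (f : (Fin d → ℝ) → (Fin k → ℝ)) (hf : RealAlg.IsRationalMapOn f Γ)
    (Θ₀ : Set (Fin k → ℝ)) (hΘ₀ : Θ₀ = f '' Γ)
    (γ₀ : Fin d → ℝ) (hγ₀ : γ₀ ∈ Γ)
    (θ₀ : Fin k → ℝ) (hθ₀ : θ₀ = f γ₀)
    (hns : ¬ RealAlg.IsSingularPoint Θ₀ θ₀)
    (hJ : (RealAlg.jacobian f γ₀).rank = min k d) :
    θ₀ ∈ RealAlg.relInterior Θ₀ := by
  subst hΘ₀ hθ₀
  have hΓn : Γ ∈ 𝓝 γ₀ := hΓ_open.mem_nhds hγ₀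
  have hmem : f γ₀ ∈ f '' Γ := Set.mem_image_of_mem f hγ₀
  have hmemV := RealAlg.subset_zariskiClosure _ hmem
  suffices h : ∀ᶠ y in 𝓝 (f γ₀), y ∈ RealAlg.zariskiClosure (f '' Γ) → y ∈ f '' Γ by
    obtain ⟨O, hO, hO_open, hOm⟩ := eventually_nhds_iff.1 h
    exact ⟨O ∩ RealAlg.zariskiClosure (f '' Γ), ⟨fun y hy => hO y hy.1 hy.2, O, hO_open, rfl⟩,
      hOm, hmemV⟩
  have hf' := hf.hasStrictFDerivAt hΓn
  set f' := fderiv ℝ f γ₀ with hf'_def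
  have hrank : Module.finrank ℝ (LinearMap.range (f' : (Fin d → ℝ) →ₗ[ℝ] (Fin k → ℝ))) =
      min k d := by
    rw [← hJ, RealAlg.jacobian, Matrix.rank, ← Matrix.toLin'_apply', Matrix.toLin'_toMatrix']
  rcases le_or_gt k d with hkd | hdk
  · have hsurj : LinearMap.range (f' : (Fin d → ℝ) →ₗ[ℝ] (Fin k → ℝ)) = ⊤ :=
      Submodule.eq_top_of_finrank_eq (by rw [hrank, min_eq_left hkd, Module.finrank_fin_fun])
    have h : f '' Γ ∈ 𝓝 (f γ₀) := by
      rw [← hf'.map_nhds_eq_of_surj hsurj]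
      exact image_mem_map hΓn
    filter_upwards [h] with y hy _ using hy
  · rw [min_eq_right hdk.le] at hrank
    obtain ⟨φ, hφ⟩ := hf.exists_algHom hΓ_open ⟨γ₀, hγ₀⟩
    obtain ⟨l, g, hg⟩ := Submodule.fg_iff_exists_fin_generating_family.1
      (IsNoetherian.noetherian (vanishingIdeal ℝ (f '' Γ)))
    obtain ⟨θ, hθ, hdim⟩ := RealAlg.exists_finrank_ker_polyJacobian_le φ hφ hg
    have hirr := RealAlg.isIrreducibleVariety_zariskiClosure
      (hφ ▸ RingHom.ker_isPrime φ : (vanishingIdeal ℝ (f '' Γ)).IsPrime)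
    -- Nonsingularity enters here: `V` is its own component, so the rank at `f γ₀` is not below the
    -- rank at `θ`.
    have hle : (RealAlg.polyJacobian g θ).rank ≤ (RealAlg.polyJacobian g (f γ₀)).rank := by
      by_contra! hlt
      exact hns ⟨hmem, Or.inl ⟨_, RealAlg.isComponent_self hirr, hmemV, l, g,
        hg.trans (RealAlg.vanishingIdeal_zariskiClosure _).symm, θ,
        RealAlg.subset_zariskiClosure _ hθ, hlt⟩⟩
    have hker : Module.finrank ℝ
        (LinearMap.ker (RealAlg.polyJacobian g (f γ₀)).mulVecLin) ≤ d := by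
      have h1 := RealAlg.finrank_ker_polyJacobian g θ
      have h2 := RealAlg.finrank_ker_polyJacobian g (f γ₀)
      omega
    have hgV : ∀ y ∈ RealAlg.zariskiClosure (f '' Γ), ∀ i, eval y (g i) = 0 := fun y hy i =>
      hy (g i) (hg ▸ Submodule.subset_span (Set.mem_range_self i))
    have hg' := RealAlg.hasStrictFDerivAt_polyJacobian g (f γ₀)
    have hfg : ∀ x ∈ Γ, (fun i => eval (f x) (g i)) = 0 := fun x hx =>
      funext fun i => hgV _ (RealAlg.subset_zariskiClosure _ (Set.mem_image_of_mem f hx)) i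
    -- Chain rule: `g ∘ f` is zero near `γ₀`.
    have hcomp : ∀ v, (RealAlg.polyJacobian g (f γ₀)).mulVecLin (f' v) = 0 := by
      have h0 := (hg'.comp γ₀ hf').hasFDerivAt.unique
        ((hasFDerivAt_const (0 : Fin l → ℝ) γ₀).congr_of_eventuallyEq
          (by filter_upwards [hΓn] with x hx using hfg x hx))
      exact fun v => DFunLike.congr_fun h0 v
    have hrange : LinearMap.range (f' : (Fin d → ℝ) →ₗ[ℝ] (Fin k → ℝ)) =
        LinearMap.ker (RealAlg.polyJacobian g (f γ₀)).mulVecLin := by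
      refine Submodule.eq_of_le_of_finrank_le ?_ (hker.trans hrank.ge)
      rintro _ ⟨v, rfl⟩
      exact hcomp v
    have hinj : Function.Injective f' := by
      have h := (f' : (Fin d → ℝ) →ₗ[ℝ] (Fin k → ℝ)).finrank_range_add_finrank_ker
      rw [hrank, Module.finrank_fin_fun, Nat.add_eq_left, Submodule.finrank_eq_zero] at h
      exact LinearMap.ker_eq_bot.1 h
    filter_upwards [hf'.eventually_mem_image_of_ker_le_range hg' hinj
      (fun y hy => hrange.ge hy) hΓn hfg] with y hy hyV
    exact hy (funext fun i => hgV y hyV i)
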